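/- **Proposition 4.5.** Let $N\ge 2$ and $k\ge 1$ be integers. Let $P_+^k$ be the set of weights $\lambda=\sum_{i=1}^{N-1}\lambda_i\Lambda_i$ of $\mathfrak{sl}_N$ with integers $\lambda_i\ge 0$ and $\sum_{i=1}^{N-1}\lambda_i\le k$ (they label the simple objects $V_\lambda$ of $\mathcal C(\mathfrak{sl}_N,k)$), and put $\lambda_0=k-\sum_{i=1}^{N-1}\lambda_i$ and $t(\lambda)=\sum_{i=1}^{N-1} i\lambda_i$. Reading indices modulo $N$, let $\tau(\lambda)$ be the weight with $\tau(\lambda)_i=\lambda_{i-1}$ and $\lambda^*$ the dual weight, $(\lambda^*)_i=\lambda_{-i}$. Put $\hat k=k+N$ if $Nk$ is odd and $\hat k=k$ otherwise. Call $d$ *admissible* if $d\mid \frac N2$ in the case that $N$ is even and $k$ is odd, and if $d\mid N$ otherwise. For admissible $d$, the modular invariant $Z(d,+)$ of the simple current module category $\mathcal M_{d,+}$ is the matrix indexed by $P_+^k$ with entries $$Z(d,+)_{\lambda,\nu}=\sum_{i=1}^{d}\delta^d\!\left(t(\lambda)+\frac{Ni\hat k}{2d}\right)\delta_{\nu,\tau^{iN/d}(\lambda)},$$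 where $\delta^d(L)=1$ if $d\mid L$ and $\delta^d(L)=0$ otherwise. The charge conjugation modular invariant is $Z(1,-)_{\lambda,\nu}=\delta_{\lambda,\nu^*}$. Let $m_d=\gcd(d,Nk/d)$ if $N$ is odd and $m_d=\gcd(d,Nk/(2d))$ if $N$ is even. Let $v_p(n)$ be the exponent of $p$ in $n$. For primes $p\mid N$ let $\vec a(d)_p=+1$ if $v_p(d)=v_p(m_d)$ and $\vec a(d)_p=-1$ otherwise. For $\vec a,\vec b\in\{+1,-1\}^{\{p\,:\,p\mid N\}}$ write $\vec a\sim_m\vec b$ if $\vec a_p=\vec b_p$ for every prime $p\mid N$ with $v_p(k)\le v_p(m)+e_p$ and $2v_p(m)+e_p<v_p(N)+v_p(k)$, where $e_2=1$ and $e_p=0$ for odd $p$. Then: 1. $Z(1,-)^2=Z(1,+)$. 2. $Z(1,-)\,Z(d,+)=Z(d,+)\,Z(1,-)$ for every admissible $d$. 3. For all admissible $d',d''$ there is exactly one admissible $d$ with $m_d=\operatorname{lcm}(m_{d'},m_{d''})$ and $\vec a(d)\sim_{m_d}\vec a(d')\,\vec a(d'')$ (componentwise product), and for this $d$ $$Z(d',+)\,Z(d'',+)=Z(d'',+)\,Z(d',+)=\gcd(m_{d'},m_{d''})\,Z(d,+).$$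 -/

import Mathlib

namespace SLModInv

/-- The set `P_+^k(sl_N)` of level `k` dominant integral weights of `sl_N`, which indexes the simple
objects of `C(sl_N, k)`. A weight `∑_{i=1}^{N-1} λ_i Λ_i` with `λ_1 + ... + λ_{N-1} ≤ k` is recorded
together with its zeroth (affine) label `λ_0 = k - (λ_1 + ... + λ_{N-1}) ≥ 0`; the labels
`λ_0, ..., λ_{N-1}` are indexed by `ℤ/N` and add up to `k`. -/
abbrev Weight (N k : ℕ) [NeZero N] : Type :=
  {l : ZMod N → ℕ // ∑ i, l i = k}

instance (N k : ℕ) [NeZero N] : Fintype (Weight N k) :=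
  Fintype.subtype (Finset.piAntidiag Finset.univ k) (by simp)

section
variable {N k : ℕ} [NeZero N]

/-- `t(λ) = ∑_{i=1}^{N-1} i λ_i`. -/
def grade (l : Weight N k) : ℕ := ∑ i : ZMod N, i.val * l.1 i

/-- The action `τ` of the invertible object `V_{[k]}`. The Young diagram with row lengths
`λ_j + λ_{j+1} + ... + λ_{N-1}` (`1 ≤ j ≤ N - 1`) gets a new top row of length `k`, and the
`λ_{N-1}` columns that now have `N` boxes are deleted. So the new labels are
`k - (λ_1 + ... + λ_{N-1}) = λ_0, λ_1, ..., λ_{N-2}`, and the new zeroth label is `λ_{N-1}`: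
the labels are rotated by one step. -/
def tau (l : Weight N k) : Weight N k :=
  ⟨fun i => l.1 (i - 1), (Equiv.sum_comp (Equiv.subRight (1 : ZMod N)) l.1).trans l.2⟩

/-- Duality `V_{λ*} = (V_λ)*`: `(λ*)_i = λ_{N-i}` for `1 ≤ i ≤ N - 1`, and `(λ*)_0 = λ_0`. -/
def dual (l : Weight N k) : Weight N k :=
  ⟨fun i => l.1 (-i), (Equiv.sum_comp (Equiv.neg (ZMod N)) l.1).trans l.2⟩

end

/-- `k̂ = k + N` if `N k` is odd and `k̂ = k` otherwise. -/
def kHat (N k : ℕ) : ℕ := if Odd (N * k) then k + N else k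

/-- The labels `d` of the simple current module categories: the divisors of `N / 2` if `N` is even
and `k` is odd, and the divisors of `N` otherwise. -/
def Admissible (N k d : ℕ) : Prop :=
  if Even N ∧ Odd k then d ∣ N / 2 else d ∣ N

/-- The modular invariant `Z(d,+)`:
`Z(d,+)_{λ,ν} = ∑_{i=1}^{d} δ^d(t(λ) + N i k̂ / (2d)) δ_{ν, τ^{i N/d}(λ)}`, where `δ^d(L)` is `1` if
`d ∣ L` and `0` otherwise. The two divisions are exact for admissible `d`. -/
def Zplus (N k : ℕ) [NeZero N] (d : ℕ) : Matrix (Weight N k) (Weight N k) ℕ :=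
  Matrix.of fun l n => ∑ i ∈ Finset.Icc 1 d,
    (if d ∣ grade l + N * i * kHat N k / (2 * d) then 1 else 0) *
      (if n = tau^[i * (N / d)] l then 1 else 0)

/-- The charge conjugation modular invariant `Z(1,-)_{λ,ν} = δ_{λ,ν*}`. -/
def Zminus (N k : ℕ) [NeZero N] : Matrix (Weight N k) (Weight N k) ℕ :=
  Matrix.of fun l n => if l = dual n then 1 else 0

/-- `m_d = gcd(d, N k / d)` for odd `N` and `m_d = gcd(d, N k / (2d))` for even `N`
(exact divisions for admissible `d`). -/
def mOf (N k d : ℕ) : ℕ :=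
  if Odd N then Nat.gcd d (N * k / d) else Nat.gcd d (N * k / (2 * d))

/-- The sign vector `a(d)`, indexed by the primes dividing `N`: `a(d)_p = +1` if `p` has the same
exponent in `d` and in `m_d`, and `a(d)_p = -1` otherwise. -/
def signs (N k d : ℕ) : N.primeFactors → ℤˣ := fun p =>
  if d.factorization p = (mOf N k d).factorization p then 1 else -1

/-- The equivalence relation `∼_m` on sign vectors: `a ∼_m b` iff `a_p = b_p` for those primes
`p ∣ N` at which two different exponents of `p` in `d` are compatible with `m_d = m`. With `ν, κ, μ`
the exponents of `p` in `N, k, m`, the exponents that can occur are `μ` and `ν + κ - μ - e`, where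
`e = 0` for odd `p` and `e = 1` for `p = 2`, and the second one is at most `ν` and different from
the first one iff `κ ≤ μ + e` and `2 μ + e < ν + κ`. -/
def SignEquiv (N k m : ℕ) (a b : N.primeFactors → ℤˣ) : Prop :=
  ∀ p : N.primeFactors,
    k.factorization p ≤ m.factorization p + (if (p : ℕ) = 2 then 1 else 0) →
    2 * m.factorization p + (if (p : ℕ) = 2 then 1 else 0) <
      N.factorization p + k.factorization p →
    a p = b p

/-- `d` is a label with `m_d = lcm(m_{d'}, m_{d''})` and `a(d) = a(d') a(d'')`, the latter as
classes for `∼_{m_d}`. -/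
def IsProductLabel (N k d' d'' d : ℕ) : Prop :=
  Admissible N k d ∧
  mOf N k d = Nat.lcm (mOf N k d') (mOf N k d'') ∧
  SignEquiv N k (mOf N k d) (signs N k d) (signs N k d' * signs N k d'')

end SLModInv

/-!
The powers of `τ` that occur in the invariants form a cyclic group of some order `n`, and `Z(d,+)`
is the matrix attached to the indicator function of the condition `d s = 0`,
`(n / d) (t + s h) = 0` on the grade `t` of a weight and a shift `s` of it, where a shift by `s`
changes the grade by `2 h s`. A product of two such matrices is attached to a convolution, so its
entries count the `u` for which `(t, u)` satisfies the condition for `d'` and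
`(t + 2 h u, s - u)` the one for `d''`. These `u` form a coset of the group annihilated by
`gcd (m_{d'}, m_{d''})` unless there are none. After splitting off the common factors of `d'` and
`d''`, Bezout's identity shows that there is such a `u` exactly when `(t, s)` satisfies the
condition for `gcd (lcm (d', d''), n h / gcd (d', d''))`. Comparing the exponents of each prime
identifies this divisor of `n` by its number `m_d` and its class of sign vectors. Charge conjugation
negates both `t` and `s`, which preserves the condition.
-/

namespace SLModInv

section ActionMatrix
variable {G X R : Type*} [Fintype G] [DecidableEq X] [Semiring R]

/-- The matrix of a function `f : X → G → R` on the action groupoid of `G` on `X`: its entry at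
`(x, y)` adds up `f x s` over the arrows `s` from `x` to `y`. -/
def actionMatrix [VAdd G X] (f : X → G → R) : Matrix X X R :=
  Matrix.of fun x y => ∑ s, if y = s +ᵥ x then f x s else 0

/-- The convolution product of functions on the action groupoid of `G` on `X`. -/
def convolution [Sub G] [VAdd G X] (f f' : X → G → R) : X → G → R :=
  fun x s => ∑ u, f x u * f' (u +ᵥ x) (s - u)

theorem actionMatrix_mul [AddGroup G] [AddAction G X] [Fintype X] (f f' : X → G → R) :
    actionMatrix f * actionMatrix f' = actionMatrix (convolution f f') := by
  ext x y
  calc (actionMatrix f * actionMatrix f') x y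
      = ∑ u, f x u * actionMatrix f' (u +ᵥ x) y := by
        simp only [Matrix.mul_apply, actionMatrix, Matrix.of_apply, Finset.sum_mul, ite_mul,
          zero_mul]
        rw [Finset.sum_comm]
        simp only [Finset.sum_ite_eq', Finset.mem_univ, if_true]
    _ = ∑ u, ∑ s, if y = s +ᵥ x then f x u * f' (u +ᵥ x) (s - u) else 0 := by
        refine Finset.sum_congr rfl fun u _ => ?_
        simp only [actionMatrix, Matrix.of_apply, Finset.mul_sum, mul_ite, mul_zero]
        refine Fintype.sum_equiv (Equiv.addRight u) _ _ fun v => ?_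
        simp only [Equiv.coe_addRight, add_vadd, add_sub_cancel_right]
    _ = actionMatrix (convolution f f') x y := by
        rw [Finset.sum_comm]
        simp only [actionMatrix, convolution, Matrix.of_apply, Finset.sum_ite_irrel,
          Finset.sum_const_zero]

theorem actionMatrix_nsmul [VAdd G X] (m : ℕ) (f : X → G → R) :
    actionMatrix (m • f) = m • actionMatrix f := by
  ext x y
  simp only [actionMatrix, Matrix.of_apply, Matrix.smul_apply, Finset.smul_sum, Pi.smul_apply,
    smul_ite, smul_zero]

theorem permMatrix_mul_actionMatrix [VAdd G X] [Fintype X] {f : X → G → R} (σ : Equiv.Perm X)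
    (φ : Equiv.Perm G) (hσ : ∀ s x, σ (s +ᵥ x) = φ s +ᵥ σ x) (hf : ∀ x s, f (σ x) (φ s) = f x s) :
    σ.permMatrix R * actionMatrix f = actionMatrix f * σ.permMatrix R := by
  rw [Equiv.Perm.permMatrix, PEquiv.toMatrix_toPEquiv_mul, PEquiv.mul_toMatrix_toPEquiv]
  ext x y
  refine (Fintype.sum_equiv φ _ _ fun s => ?_).symm
  simp only [id_eq, Equiv.symm_apply_eq, hσ, hf]

end ActionMatrix

section Congruences

theorem exists_mul_eq_zero_iff {R : Type*} [CommRing R] {α β e f g q h : R}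
    (hαβ : IsCoprime α β) (hgq : IsCoprime g q) (heh : e * h = f * q)
    (h0 : f * g * α * β * e = 0) (hker : ∀ y, g * e * y = 0 → α * β * f ∣ y) (t s : R) :
    (∃ u, (f * g * α * u = 0 ∧ β * e * (t + u * h) = 0) ∧
        f * g * β * (s - u) = 0 ∧ α * e * (t + u * (2 * h) + (s - u) * h) = 0) ↔
      α * β * f * s = 0 ∧ g * e * (t + s * h) = 0 := by
  obtain ⟨i, j, hij⟩ := hαβ
  obtain ⟨x, z, hxz⟩ := hgq
  constructor
  · rintro ⟨u, ⟨hu, htu⟩, hv, htv⟩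
    constructor
    · have hg : g * (α * β * f * s) = 0 := by linear_combination β * hu + α * hv
      have hq : q * (α * β * f * s) = 0 := by
        linear_combination β * htv - α * htu - α * β * s * heh
      linear_combination -(α * β * f * s) * hxz + x * hg + z * hq
    · have hα : α * (g * e * (t + s * h)) = 0 := by
        linear_combination g * htv - q * hu - g * α * u * heh
      have hβ : β * (g * e * (t + s * h)) = 0 := by
        linear_combination g * htu + q * hv + g * β * (s - u) * heh
      linear_combination -(g * e * (t + s * h)) * hij + i * hα + j * hβ
  · rintro ⟨hs, ht⟩
    obtain ⟨y, hy⟩ := hker _ ht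
    -- `u = j β s` meets the grade conditions up to multiples of `y`; the second term corrects this.
    refine ⟨j * β * s - α * β * e * z * y, ⟨?_, ?_⟩, ?_, ?_⟩
    · linear_combination j * g * hs - α * z * y * h0
    · linear_combination β * e * hy + β * x * y * h0 - i * q * hs -
        (i * α * β * s + α * β ^ 2 * e * z * y) * heh - α * β ^ 2 * e * f * y * hxz +
        β * e * h * s * hij
    · linear_combination i * g * hs + β * z * y * h0 - f * g * β * s * hij
    · linear_combination α * e * hy + α * x * y * h0 + j * q * hs +
        (j * α * β * s - α ^ 2 * β * e * z * y) * heh - α ^ 2 * β * e * f * y * hxz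

theorem natCast_gcd_mul_eq_zero_iff {R : Type*} [CommRing R] (a b : ℕ) (w : R) :
    ((Nat.gcd a b : ℕ) : R) * w = 0 ↔ (a : R) * w = 0 ∧ (b : R) * w = 0 := by
  constructor
  · intro hw
    have of_dvd : ∀ {c : ℕ}, Nat.gcd a b ∣ c → (c : R) * w = 0 := by
      rintro _ ⟨c, rfl⟩
      rw [Nat.cast_mul, mul_right_comm, hw, zero_mul]
    exact ⟨of_dvd (Nat.gcd_dvd_left a b), of_dvd (Nat.gcd_dvd_right a b)⟩
  · rintro ⟨ha, hb⟩
    have bezout := congrArg (Int.cast : ℤ → R) (Nat.gcd_eq_gcd_ab a b)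
    push_cast at bezout
    linear_combination w * bezout + (a.gcdA b : R) * ha + (a.gcdB b : R) * hb

variable {n a b : ℕ}

theorem exists_coprime_factors (h : ℕ) (ha : a ∣ n) (hb : b ∣ n) :
    ∃ α β e f g q : ℕ, α.Coprime β ∧ g.Coprime q ∧ a = f * g * α ∧ b = f * g * β ∧
      n = f * g * α * β * e ∧ e * h = f * q := by
  obtain ⟨α, β, hαβ, ha', hb'⟩ := Nat.exists_coprime a b
  have hlcm : Nat.lcm a b = α * β * Nat.gcd a b := by
    rw [← hαβ.lcm_eq_mul, ← Nat.lcm_mul_right, ← ha', ← hb']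
  obtain ⟨e, he⟩ := Nat.lcm_dvd ha hb
  obtain ⟨g, q, hgq, hg, hq⟩ := Nat.exists_coprime (Nat.gcd a b) (e * h)
  generalize Nat.gcd (Nat.gcd a b) (e * h) = f at hg hq
  rw [hlcm] at he
  rw [hg] at ha' hb' he
  exact ⟨α, β, e, f, g, q, hαβ, hgq, by linarith, by linarith, by linarith, by linarith⟩

/-- The label of the product of the invariants labelled `a` and `b`, when these are divisors of the
order `n` of the group of shifts and a shift by `1` changes the grade by `2 * h`. -/
def prodLabel (n h a b : ℕ) : ℕ := Nat.gcd (Nat.lcm a b) (n / Nat.gcd a b * h)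

theorem prodLabel_comm (n h a b : ℕ) : prodLabel n h a b = prodLabel n h b a := by
  rw [prodLabel, prodLabel, Nat.lcm_comm, Nat.gcd_comm a b]

theorem prodLabel_eq_of_coprime {α β e f g q h : ℕ} (hαβ : α.Coprime β) (hgq : g.Coprime q)
    (heh : e * h = f * q) (hfg : 0 < f * g) :
    prodLabel (f * g * α * β * e) h (f * g * α) (f * g * β) = α * β * f := by
  have hgcd : Nat.gcd (f * g * α) (f * g * β) = f * g := by
    rw [Nat.gcd_mul_left, hαβ.gcd_eq_one, mul_one]
  have hlcm : Nat.lcm (f * g * α) (f * g * β) = α * β * f * g := by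
    rw [Nat.lcm_mul_left, hαβ.lcm_eq_mul]
    ring
  have hquot : f * g * α * β * e / (f * g) * h = α * β * f * q := by
    rw [mul_assoc (f * g), mul_assoc (f * g), Nat.mul_div_cancel_left _ hfg, mul_assoc, heh]
    ring
  rw [prodLabel, hgcd, hlcm, hquot, Nat.gcd_mul_left, hgq.gcd_eq_one, mul_one]

theorem prodLabel_dvd (h : ℕ) (ha : a ∣ n) (hb : b ∣ n) : prodLabel n h a b ∣ n :=
  (Nat.gcd_dvd_left _ _).trans (Nat.lcm_dvd ha hb)

/-- The condition on the grade `t` of a weight and a shift `s` under which the shifted weight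
contributes to the row of the weight in the invariant labelled `d`. For `d ∣ n`, annihilation by `d`
and by `n / d` in `ZMod n` encodes divisibility by `n / d` and by `d`, respectively. -/
def Contributes (n h d : ℕ) (t s : ZMod n) : Prop :=
  (d : ZMod n) * s = 0 ∧ ((n / d : ℕ) : ZMod n) * (t + s * h) = 0

instance (n h d : ℕ) (t s : ZMod n) : Decidable (Contributes n h d t s) :=
  inferInstanceAs (Decidable (_ ∧ _))

theorem contributes_neg_neg {h d : ℕ} {t s : ZMod n} :
    Contributes n h d (-t) (-s) ↔ Contributes n h d t s := by
  rw [Contributes, Contributes, neg_mul, ← neg_add, mul_neg, mul_neg, neg_eq_zero, neg_eq_zero]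

theorem natCast_mul_natCast_eq_zero_iff [NeZero n] {c c' : ℕ} (hn : c * c' = n) (x : ℕ) :
    (c' : ZMod n) * (x : ZMod n) = 0 ↔ c ∣ x := by
  have hc' : 0 < c' := Nat.pos_of_ne_zero (right_ne_zero_of_mul (hn ▸ NeZero.ne n))
  rw [← Nat.cast_mul, ZMod.natCast_eq_zero_iff, ← hn, mul_comm c, Nat.mul_dvd_mul_iff_left hc']

theorem natCast_dvd_of_mul_eq_zero [NeZero n] {c c' : ℕ} (hn : c * c' = n) {y : ZMod n}
    (hy : (c' : ZMod n) * y = 0) : (c : ZMod n) ∣ y := by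
  rw [← ZMod.natCast_zmod_val y] at hy ⊢
  exact Nat.cast_dvd_cast ((natCast_mul_natCast_eq_zero_iff hn _).1 hy)

theorem exists_contributes_iff [NeZero n] (h : ℕ) (ha : a ∣ n) (hb : b ∣ n) (t s : ZMod n) :
    (∃ u, Contributes n h a t u ∧ Contributes n h b (t + u * (2 * h)) (s - u)) ↔
      Contributes n h (prodLabel n h a b) t s := by
  obtain ⟨α, β, e, f, g, q, hαβ, hgq, rfl, rfl, rfl, heh⟩ := exists_coprime_factors h ha hb
  have hn : 0 < f * g * α * β * e := NeZero.pos _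
  have hfg : 0 < f * g :=
    Nat.pos_of_dvd_of_pos ⟨α * β * e, by ring⟩ hn
  have quotient_eq : ∀ {x y : ℕ}, x * y = f * g * α * β * e → f * g * α * β * e / x = y :=
    fun hxy => Nat.div_eq_of_eq_mul_right (Nat.pos_of_mul_pos_right (hxy ▸ hn)) hxy.symm
  have hprod := prodLabel_eq_of_coprime hαβ hgq heh hfg
  have hker (y : ZMod (f * g * α * β * e)) (hy : (g * e : ZMod (f * g * α * β * e)) * y = 0) :
      (α * β * f : ZMod (f * g * α * β * e)) ∣ y :=
    mod_cast natCast_dvd_of_mul_eq_zero (c := α * β * f) (c' := g * e) (by ring)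
      (by rwa [Nat.cast_mul])
  rw [hprod]
  simp only [Contributes, quotient_eq (x := f * g * α) (y := β * e) (by ring),
    quotient_eq (x := f * g * β) (y := α * e) (by ring),
    quotient_eq (x := α * β * f) (y := g * e) (by ring), Nat.cast_mul]
  exact exists_mul_eq_zero_iff hαβ.cast hgq.cast (mod_cast congrArg Nat.cast heh)
    (mod_cast ZMod.natCast_self _) hker t s

theorem sum_Icc_eq_sum_mul_eq_zero [NeZero n] {d : ℕ} (hd : d ∣ n) {M : Type*} [AddCommMonoid M]
    (F : ZMod n → M) :
    ∑ i ∈ Finset.Icc 1 d, F ((i * (n / d) : ℕ) : ZMod n) =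
      ∑ s with (d : ZMod n) * s = 0, F s := by
  obtain ⟨e, he⟩ := hd
  have hd0 : 0 < d := Nat.pos_of_ne_zero (left_ne_zero_of_mul (he ▸ NeZero.ne n))
  have he0 : 0 < e := Nat.pos_of_ne_zero (right_ne_zero_of_mul (he ▸ NeZero.ne n))
  have hdiv : n / d = e := Nat.div_eq_of_eq_mul_right hd0 he
  have hends : F ((d * e : ℕ) : ZMod n) = F ((0 * e : ℕ) : ZMod n) := by
    rw [← he, zero_mul, Nat.cast_zero, ZMod.natCast_self]
  rw [hdiv, ← Finset.Ico_add_one_right_eq_Icc, Finset.sum_Ico_succ_top hd0, hends, add_comm,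
    ← Finset.sum_range_eq_add_Ico (fun i => F ((i * e : ℕ) : ZMod n)) hd0]
  refine Finset.sum_nbij' (fun i => ((i * e : ℕ) : ZMod n)) (fun s => s.val / e) ?_ ?_ ?_ ?_
    fun _ _ => rfl
  · intro i _
    simp only [Finset.mem_filter, Finset.mem_univ, true_and]
    exact (natCast_mul_natCast_eq_zero_iff (he ▸ mul_comm e d) _).2 (dvd_mul_left e i)
  · intro s _
    exact Finset.mem_range.2 (Nat.div_lt_of_lt_mul (mul_comm d e ▸ he ▸ s.val_lt))
  · intro i hi
    have hlt : i * e < n := he ▸ Nat.mul_lt_mul_of_pos_right (Finset.mem_range.1 hi) he0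
    simp only [ZMod.val_cast_of_lt hlt, Nat.mul_div_cancel _ he0]
  · intro s hs
    have hes : e ∣ s.val := by
      rw [← natCast_mul_natCast_eq_zero_iff (he ▸ mul_comm e d), ZMod.natCast_zmod_val]
      exact (Finset.mem_filter.1 hs).2
    simp only [Nat.div_mul_cancel hes, ZMod.natCast_zmod_val]

theorem card_mul_eq_zero [NeZero n] {d : ℕ} (hd : d ∣ n) :
    (Finset.univ.filter fun s : ZMod n => (d : ZMod n) * s = 0).card = d := by
  rw [Finset.card_eq_sum_ones, ← sum_Icc_eq_sum_mul_eq_zero hd fun _ => 1]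
  simp

theorem card_contributes [NeZero n] (h : ℕ) (ha : a ∣ n) (hb : b ∣ n) (t s : ZMod n) :
    (Finset.univ.filter fun u =>
        Contributes n h a t u ∧ Contributes n h b (t + u * (2 * h)) (s - u)).card =
      if Contributes n h (prodLabel n h a b) t s then
        Nat.gcd (Nat.gcd a (n / a * h)) (Nat.gcd b (n / b * h)) else 0 := by
  split_ifs with H
  · obtain ⟨u₀, ⟨hu, htu⟩, hv, htv⟩ := (exists_contributes_iff h ha hb t s).2 H
    rw [← card_mul_eq_zero ((Nat.gcd_dvd_left _ _).trans ((Nat.gcd_dvd_left a _).trans ha))]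
    refine (Finset.card_equiv (Equiv.addRight u₀) fun w => ?_).symm
    simp only [Finset.mem_filter_univ, Equiv.coe_addRight]
    simp only [Contributes, natCast_gcd_mul_eq_zero_iff, Nat.cast_mul]
    refine and_congr (and_congr ?_ ?_) (and_congr ?_ ?_)
    · rw [mul_add, hu, add_zero]
    · exact Eq.congr_left (by linear_combination -htu)
    · rw [← neg_eq_zero]
      exact Eq.congr_left (by linear_combination -hv)
    · exact Eq.congr_left (by linear_combination -htv)
  · rw [Finset.card_eq_zero, Finset.filter_eq_empty_iff]
    exact fun u _ hu => H ((exists_contributes_iff h ha hb t s).1 ⟨u, hu⟩)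

end Congruences

section Parameters

/-- The invariants `Z(d,+)` only involve powers of `τ` to multiples of this number. -/
def stride (N k : ℕ) : ℕ := if Even N ∧ Odd k then 2 else 1

/-- The admissible labels are the divisors of this number, which is also the order of the group of
shifts that occur in the invariants `Z(d,+)`. -/
def labelModulus (N k : ℕ) : ℕ := N / stride N k

/-- Half the change of the grade, modulo `labelModulus N k`, under `τ ^ stride N k`. The division is
exact. -/
def halfGradeShift (N k : ℕ) : ℕ := stride N k * kHat N k / 2

variable {N k d : ℕ}

theorem stride_mul_labelModulus (N k : ℕ) : stride N k * labelModulus N k = N := by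
  refine Nat.mul_div_cancel' ?_
  rw [stride]
  split_ifs with hNk
  exacts [hNk.1.two_dvd, one_dvd N]

instance [NeZero N] : NeZero (labelModulus N k) :=
  ⟨right_ne_zero_of_mul ((stride_mul_labelModulus N k).symm ▸ NeZero.ne N)⟩

theorem labelModulus_dvd (N k : ℕ) : labelModulus N k ∣ N :=
  Dvd.intro_left _ (stride_mul_labelModulus N k)

theorem stride_eq_one_of_odd (hN : Odd N) : stride N k = 1 :=
  if_neg fun hNk => Nat.not_even_iff_odd.2 hN hNk.1

theorem labelModulus_eq_of_odd (hN : Odd N) : labelModulus N k = N := by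
  rw [labelModulus, stride_eq_one_of_odd hN, Nat.div_one]

theorem kHat_eq_of_even (hN : Even N) : kHat N k = k :=
  if_neg (Nat.not_odd_iff_even.2 (hN.mul_right k))

theorem kHat_eq_or (N k : ℕ) : kHat N k = k ∨ kHat N k = k + N := by
  rw [kHat]
  split_ifs
  exacts [Or.inr rfl, Or.inl rfl]

theorem natCast_kHat {n : ℕ} (hn : n ∣ N) (k : ℕ) : (kHat N k : ZMod n) = k := by
  rcases kHat_eq_or N k with hk | hk <;> rw [hk]
  rw [Nat.cast_add, (ZMod.natCast_eq_zero_iff N n).2 hn, add_zero]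

theorem two_mul_halfGradeShift (N k : ℕ) : 2 * halfGradeShift N k = stride N k * kHat N k := by
  refine Nat.two_mul_div_two_of_even ?_
  rw [stride, kHat]
  split_ifs <;> grind

theorem two_mul_halfGradeShift_of_odd (hN : Odd N) : 2 * halfGradeShift N k = kHat N k := by
  rw [two_mul_halfGradeShift, stride_eq_one_of_odd hN, one_mul]

theorem mul_kHat (N k : ℕ) :
    N * kHat N k = 2 * (labelModulus N k * halfGradeShift N k) := by
  rw [mul_left_comm, two_mul_halfGradeShift, mul_left_comm, ← mul_assoc, stride_mul_labelModulus]

theorem halfGradeShift_ne_zero [NeZero N] (hk : k ≠ 0) : halfGradeShift N k ≠ 0 := by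
  have hkHat : kHat N k ≠ 0 := by rcases kHat_eq_or N k with h | h <;> omega
  have := right_ne_zero_of_mul (mul_kHat N k ▸ mul_ne_zero (NeZero.ne N) hkHat)
  exact right_ne_zero_of_mul this

theorem admissible_iff : Admissible N k d ↔ d ∣ labelModulus N k := by
  rw [Admissible, labelModulus, stride]
  split_ifs
  exacts [Iff.rfl, (Nat.div_one N).symm ▸ Iff.rfl]

theorem mul_div_eq_stride_mul (hd : d ∣ labelModulus N k) (i : ℕ) :
    i * (N / d) = stride N k * (i * (labelModulus N k / d)) := by
  rw [mul_left_comm, ← Nat.mul_div_assoc _ hd, stride_mul_labelModulus]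

theorem mul_mul_kHat_div (hd : d ∣ labelModulus N k) (i : ℕ) :
    N * i * kHat N k / (2 * d) = i * (labelModulus N k / d) * halfGradeShift N k := by
  rw [mul_right_comm, mul_kHat, mul_assoc, Nat.mul_div_mul_left _ _ two_pos, mul_assoc,
    ← Nat.div_mul_right_comm hd]
  ring

theorem mOf_eq [NeZero N] (hd : d ∣ labelModulus N k) :
    mOf N k d = Nat.gcd d (labelModulus N k / d * halfGradeShift N k) := by
  have hd0 : 0 < d := Nat.pos_of_dvd_of_pos hd (NeZero.pos _)
  rcases Nat.even_or_odd N with hN | hN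
  · rw [mOf, if_neg (Nat.not_odd_iff_even.2 hN)]
    conv_lhs => rw [← kHat_eq_of_even (k := k) hN]
    rw [mul_kHat, Nat.mul_div_mul_left _ _ two_pos, Nat.div_mul_right_comm hd]
  · have hkHat : Nat.gcd d (N / d * kHat N k) = Nat.gcd d (N / d * k) := by
      rcases kHat_eq_or N k with h | h <;> rw [h]
      rw [labelModulus_eq_of_odd hN] at hd
      rw [mul_add, Nat.gcd_add_right_right_of_dvd _ (dvd_mul_of_dvd_right hd _)]
    rw [labelModulus_eq_of_odd hN] at hd ⊢
    have htwo : Nat.Coprime 2 d := Nat.coprime_two_left.2 (hN.of_dvd_nat hd)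
    rw [mOf, if_pos hN, ← Nat.div_mul_right_comm hd, ← hkHat, ← two_mul_halfGradeShift_of_odd hN,
      mul_left_comm, htwo.gcd_mul_left_cancel_right]

/-- Multiplication by `stride N k`, which identifies the group indexing the shifts in the invariants
`Z(d,+)` with a subgroup of the group of all rotations. -/
def strideHom (N k : ℕ) : ZMod (labelModulus N k) →+ ZMod N :=
  ZMod.lift _ ⟨zmultiplesHom _ (stride N k : ZMod N), by
    rw [zmultiplesHom_apply, natCast_zsmul, nsmul_eq_mul, mul_comm, ← Nat.cast_mul,
      stride_mul_labelModulus, ZMod.natCast_self]⟩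

theorem strideHom_natCast (N k i : ℕ) : strideHom N k i = (stride N k * i : ℕ) := by
  rw [strideHom, ← Int.cast_natCast i, ZMod.lift_coe, zmultiplesHom_apply, natCast_zsmul,
    nsmul_eq_mul, mul_comm, Nat.cast_mul]

end Parameters

section Labels
variable {N k n h a b d : ℕ}

theorem factorization_le_of_dvd (hn : n ≠ 0) (hd : d ∣ n) (p : ℕ) :
    d.factorization p ≤ n.factorization p :=
  Nat.factorization_le_factorization_of_dvd_right hd (ne_zero_of_dvd_ne_zero hn hd) hn

theorem div_ne_zero_of_dvd (hn : n ≠ 0) (hd : d ∣ n) : n / d ≠ 0 :=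
  (Nat.div_ne_zero_iff_of_dvd hd).2 ⟨hn, ne_zero_of_dvd_ne_zero hn hd⟩

theorem factorization_div_mul (hn : n ≠ 0) (hh : h ≠ 0) (hd : d ∣ n) (p : ℕ) :
    (n / d * h).factorization p =
      n.factorization p - d.factorization p + h.factorization p := by
  rw [Nat.factorization_mul (div_ne_zero_of_dvd hn hd) hh, Nat.factorization_div hd,
    Finsupp.add_apply, Finsupp.tsub_apply]

theorem factorization_prodLabel (hn : n ≠ 0) (hh : h ≠ 0) (ha : a ∣ n) (hb : b ∣ n) (p : ℕ) :
    (prodLabel n h a b).factorization p =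
      min (max (a.factorization p) (b.factorization p))
        (n.factorization p - min (a.factorization p) (b.factorization p) + h.factorization p) := by
  have ha0 := ne_zero_of_dvd_ne_zero hn ha
  have hb0 := ne_zero_of_dvd_ne_zero hn hb
  have hgcd : Nat.gcd a b ∣ n := (Nat.gcd_dvd_left a b).trans ha
  rw [prodLabel, Nat.factorization_gcd (Nat.lcm_ne_zero ha0 hb0)
    (mul_ne_zero (div_ne_zero_of_dvd hn hgcd) hh), Finsupp.inf_apply,
    factorization_div_mul hn hh hgcd, Nat.factorization_lcm ha0 hb0,
    Nat.factorization_gcd ha0 hb0, Finsupp.sup_apply, Finsupp.inf_apply]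

theorem factorization_mOf [NeZero N] (hk : k ≠ 0) (hd : d ∣ labelModulus N k) (p : ℕ) :
    (mOf N k d).factorization p = min (d.factorization p)
      ((labelModulus N k).factorization p - d.factorization p +
        (halfGradeShift N k).factorization p) := by
  have hn := NeZero.ne (labelModulus N k)
  have hh := halfGradeShift_ne_zero (N := N) hk
  rw [mOf_eq hd, Nat.factorization_gcd (ne_zero_of_dvd_ne_zero hn hd)
    (mul_ne_zero (div_ne_zero_of_dvd hn hd) hh), Finsupp.inf_apply, factorization_div_mul hn hh hd]

theorem mOf_ne_zero [NeZero N] (hd : d ∣ labelModulus N k) : mOf N k d ≠ 0 := by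
  rw [mOf_eq hd]
  exact Nat.gcd_ne_zero_left (ne_zero_of_dvd_ne_zero (NeZero.ne _) hd)

theorem mOf_dvd [NeZero N] (hd : d ∣ labelModulus N k) : mOf N k d ∣ labelModulus N k :=
  mOf_eq hd ▸ (Nat.gcd_dvd_left _ _).trans hd

theorem factorization_two_mul (hn : n ≠ 0) (p : ℕ) :
    (2 * n).factorization p = (if p = 2 then 1 else 0) + n.factorization p := by
  rw [Nat.factorization_mul two_ne_zero hn, Finsupp.add_apply, Nat.prime_two.factorization,
    Finsupp.single_apply]
  simp only [eq_comm]

theorem min_factorization_eq_of_natCast_eq {x y : ℕ} (hn : n ≠ 0) (hx : x ≠ 0) (hy : y ≠ 0)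
    (hxy : (x : ZMod n) = y) (p : ℕ) :
    min (x.factorization p) (n.factorization p) = min (y.factorization p) (n.factorization p) := by
  have hgcd : Nat.gcd x n = Nat.gcd y n := ((ZMod.natCast_eq_natCast_iff x y n).1 hxy).gcd_eq
  simpa only [Nat.factorization_gcd hx hn, Nat.factorization_gcd hy hn, Finsupp.inf_apply] using
    congrArg (fun m => m.factorization p) hgcd

theorem signEquiv_condition_iff [NeZero N] (hk : k ≠ 0) {p μ : ℕ} (hp : p ∣ N)
    (hμ : μ ≤ (labelModulus N k).factorization p) :
    (k.factorization p ≤ μ + (if p = 2 then 1 else 0) ∧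
      2 * μ + (if p = 2 then 1 else 0) < N.factorization p + k.factorization p) ↔
    (halfGradeShift N k).factorization p ≤ μ ∧
      2 * μ < (labelModulus N k).factorization p + (halfGradeShift N k).factorization p := by
  have hh := halfGradeShift_ne_zero (N := N) hk
  have hhp := factorization_two_mul hh p
  rcases Nat.even_or_odd N with hN | hN
  · have hnh := congrArg (fun m => m.factorization p) (mul_kHat N k)
    simp only [kHat_eq_of_even hN, factorization_two_mul (mul_ne_zero (NeZero.ne _) hh),
      Nat.factorization_mul (NeZero.ne _) hh, Nat.factorization_mul (NeZero.ne N) hk,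
      Finsupp.add_apply] at hnh
    have hkh : k.factorization p ≤ μ + (if p = 2 then 1 else 0) ↔
        (halfGradeShift N k).factorization p ≤ μ := by
      rw [two_mul_halfGradeShift, kHat_eq_of_even hN, stride] at hhp
      by_cases hNk : Even N ∧ Odd k
      · have hk2 : k.factorization 2 = 0 :=
          Nat.factorization_eq_zero_of_not_dvd hNk.2.not_two_dvd_nat
        rw [if_pos hNk, factorization_two_mul hk] at hhp
        grind
      · rw [if_neg hNk, one_mul] at hhp
        omega
    omega
  · have hp2 : p ≠ 2 := fun hp2 => Nat.not_even_iff_odd.2 hN (even_iff_two_dvd.2 (hp2 ▸ hp))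
    have hmin := min_factorization_eq_of_natCast_eq (NeZero.ne N) (mul_ne_zero two_ne_zero hh) hk
      (two_mul_halfGradeShift_of_odd (k := k) hN ▸ natCast_kHat dvd_rfl k) p
    rw [hhp] at hmin
    rw [labelModulus_eq_of_odd hN] at hμ ⊢
    simp only [if_neg hp2] at hmin ⊢
    omega

theorem signEquiv_iff [NeZero N] (hk : k ≠ 0) {m : ℕ} (hm : m ∣ labelModulus N k)
    {v w : N.primeFactors → ℤˣ} : SignEquiv N k m v w ↔
      ∀ p : N.primeFactors,
        (halfGradeShift N k).factorization p ≤ m.factorization p ∧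
          2 * m.factorization p <
            (labelModulus N k).factorization p + (halfGradeShift N k).factorization p →
        v p = w p :=
  forall_congr' fun p => by
    rw [← signEquiv_condition_iff hk (Nat.dvd_of_mem_primeFactors p.2)
      (factorization_le_of_dvd (NeZero.ne _) hm p), and_imp]

theorem sign_eq_iff (A B : Prop) [Decidable A] [Decidable B] :
    ((if A then 1 else -1 : ℤˣ) = if B then 1 else -1) ↔ (A ↔ B) := by
  split_ifs <;> simp [*]

theorem sign_mul_sign (A B : Prop) [Decidable A] [Decidable B] :
    (if A then 1 else -1 : ℤˣ) * (if B then 1 else -1) = if A ↔ B then 1 else -1 := by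
  split_ifs <;> simp_all

theorem eq_of_mOf_eq_of_signEquiv [NeZero N] (hk : k ≠ 0) (ha : a ∣ labelModulus N k)
    (hb : b ∣ labelModulus N k) (hm : mOf N k a = mOf N k b)
    (hs : SignEquiv N k (mOf N k a) (signs N k a) (signs N k b)) : a = b := by
  have hn := NeZero.ne (labelModulus N k)
  refine Nat.eq_of_factorization_eq (ne_zero_of_dvd_ne_zero hn ha) (ne_zero_of_dvd_ne_zero hn hb)
    fun p => ?_
  have hap := factorization_le_of_dvd hn ha p
  have hbp := factorization_le_of_dvd hn hb p
  have hmp := congrArg (fun m => m.factorization p) hm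
  by_cases hp : p ∈ N.primeFactors
  · have hsp := (signEquiv_iff hk (mOf_dvd ha)).1 hs ⟨p, hp⟩
    simp only [signs, sign_eq_iff, factorization_mOf hk ha, factorization_mOf hk hb] at hmp hsp
    omega
  · have hNp : N.factorization p = 0 := Finsupp.notMem_support_iff.1 hp
    have := factorization_le_of_dvd (NeZero.ne N) (labelModulus_dvd N k) p
    omega

theorem isProductLabel_prodLabel [NeZero N] (hk : k ≠ 0) (ha : a ∣ labelModulus N k)
    (hb : b ∣ labelModulus N k) :
    IsProductLabel N k a b (prodLabel (labelModulus N k) (halfGradeShift N k) a b) := by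
  have hn := NeZero.ne (labelModulus N k)
  have hd := prodLabel_dvd (halfGradeShift N k) ha hb
  have hdp := factorization_prodLabel hn (halfGradeShift_ne_zero (N := N) hk) ha hb
  generalize prodLabel (labelModulus N k) (halfGradeShift N k) a b = d at hd hdp ⊢
  have hap := factorization_le_of_dvd hn ha
  have hbp := factorization_le_of_dvd hn hb
  refine ⟨admissible_iff.2 hd, ?_, (signEquiv_iff hk (mOf_dvd hd)).2 fun p hp => ?_⟩
  · refine Nat.eq_of_factorization_eq (mOf_ne_zero hd)
      (Nat.lcm_ne_zero (mOf_ne_zero ha) (mOf_ne_zero hb)) fun p => ?_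
    rw [Nat.factorization_lcm (mOf_ne_zero ha) (mOf_ne_zero hb), Finsupp.sup_apply,
      factorization_mOf hk hd, factorization_mOf hk ha, factorization_mOf hk hb, hdp]
    grind
  · have := hap p
    have := hbp p
    have := hdp p
    simp only [signs, Pi.mul_apply, sign_mul_sign, sign_eq_iff, factorization_mOf hk hd,
      factorization_mOf hk ha, factorization_mOf hk hb] at hp ⊢
    grind

theorem isProductLabel_iff [NeZero N] (hk : k ≠ 0) (ha : a ∣ labelModulus N k)
    (hb : b ∣ labelModulus N k) : IsProductLabel N k a b d ↔
      d = prodLabel (labelModulus N k) (halfGradeShift N k) a b := by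
  have hprod := isProductLabel_prodLabel hk ha hb
  refine ⟨fun ⟨hd, hm, hs⟩ => ?_, fun hd => hd ▸ hprod⟩
  obtain ⟨hd', hm', hs'⟩ := hprod
  have hmm := hm.trans hm'.symm
  exact eq_of_mOf_eq_of_signEquiv hk (admissible_iff.1 hd) (admissible_iff.1 hd') hmm
    fun p h₁ h₂ => (hs p h₁ h₂).trans (hs' p (hmm ▸ h₁) (hmm ▸ h₂)).symm

end Labels

section Weights
variable {N k : ℕ} [NeZero N]

/-- `ZMod N` acts on the weights of level `k` by rotation of the labels; the action of `1` is the
simple current action `τ`. -/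
instance : AddAction (ZMod N) (Weight N k) where
  vadd j l := ⟨fun i => l.1 (i - j), (Equiv.sum_comp (Equiv.subRight j) l.1).trans l.2⟩
  zero_vadd l := Subtype.ext (funext fun i => congrArg l.1 (sub_zero i))
  add_vadd j₁ j₂ l := Subtype.ext (funext fun i => congrArg l.1 (sub_add_eq_sub_sub i j₁ j₂))

theorem rotate_apply (j : ZMod N) (l : Weight N k) (i : ZMod N) : (j +ᵥ l).1 i = l.1 (i - j) :=
  rfl

theorem tau_iterate_eq_vadd (j : ℕ) (l : Weight N k) : tau^[j] l = (j : ZMod N) +ᵥ l := by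
  induction j with
  | zero => rw [Function.iterate_zero_apply, Nat.cast_zero, zero_vadd]
  | succ j ih =>
    rw [Function.iterate_succ_apply', ih, Nat.cast_succ, add_comm, add_vadd]
    rfl

theorem grade_eq_sum (l : Weight N k) : (grade l : ZMod N) = ∑ i, i * (l.1 i : ZMod N) := by
  simp only [grade, Nat.cast_sum, Nat.cast_mul, ZMod.natCast_zmod_val]

theorem grade_rotate (j : ZMod N) (l : Weight N k) :
    (grade (j +ᵥ l) : ZMod N) = grade l + j * k := by
  have hk : ∑ i, (l.1 i : ZMod N) = k := mod_cast congrArg (Nat.cast : ℕ → ZMod N) l.2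
  rw [grade_eq_sum, grade_eq_sum, ← hk, Finset.mul_sum, ← Finset.sum_add_distrib]
  refine Fintype.sum_equiv (Equiv.subRight j) _ _ fun i => ?_
  rw [rotate_apply, Equiv.subRight_apply, ← add_mul, sub_add_cancel]

theorem grade_dual (l : Weight N k) : (grade (dual l) : ZMod N) = -grade l := by
  rw [grade_eq_sum, grade_eq_sum, ← Finset.sum_neg_distrib]
  exact Fintype.sum_equiv (Equiv.neg (ZMod N)) _ _ fun i => by simp [dual]

theorem dual_rotate (j : ZMod N) (l : Weight N k) : dual (j +ᵥ l) = -j +ᵥ dual l :=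
  Subtype.ext (funext fun i => congrArg l.1 (by ring))

theorem dual_involutive : Function.Involutive (dual : Weight N k → Weight N k) :=
  fun l => Subtype.ext (funext fun i => congrArg l.1 (neg_neg i))

/-- The shifts that occur in the invariants `Z(d,+)`; the action of `1` is `τ ^ stride N k`. -/
instance : AddAction (ZMod (labelModulus N k)) (Weight N k) :=
  AddAction.compHom _ (strideHom N k)

theorem natCast_shift (i : ℕ) (l : Weight N k) :
    (i : ZMod (labelModulus N k)) +ᵥ l = tau^[stride N k * i] l := by
  rw [tau_iterate_eq_vadd, ← strideHom_natCast]
  rfl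

theorem dual_shift (s : ZMod (labelModulus N k)) (l : Weight N k) :
    dual (s +ᵥ l) = -s +ᵥ dual l := by
  change dual (strideHom N k s +ᵥ l) = strideHom N k (-s) +ᵥ dual l
  rw [dual_rotate, map_neg]

theorem grade_shift (s : ZMod (labelModulus N k)) (l : Weight N k) :
    (grade (s +ᵥ l) : ZMod (labelModulus N k)) = grade l + s * (2 * halfGradeShift N k) := by
  obtain ⟨i, rfl⟩ := ZMod.natCast_zmod_surjective s
  have htwo := congrArg (Nat.cast : ℕ → ZMod (labelModulus N k)) (two_mul_halfGradeShift N k)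
  rw [Nat.cast_mul, Nat.cast_mul, natCast_kHat (labelModulus_dvd N k), Nat.cast_ofNat] at htwo
  have hgrade := congrArg (ZMod.castHom (labelModulus_dvd N k) (ZMod (labelModulus N k)))
    (grade_rotate (strideHom N k i) l)
  simp only [strideHom_natCast, map_natCast, map_add, map_mul, Nat.cast_mul] at hgrade
  rw [natCast_shift, tau_iterate_eq_vadd, Nat.cast_mul, hgrade, htwo]
  ring

end Weights

section Invariants
variable {N k a b d : ℕ} [NeZero N]

/-- The function on the action groupoid of the shifts whose matrix is `Z(d,+)`. -/
def labelKernel (N k d : ℕ) [NeZero N] (l : Weight N k) (s : ZMod (labelModulus N k)) : ℕ :=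
  if Contributes (labelModulus N k) (halfGradeShift N k) d (grade l) s then 1 else 0

theorem zplus_eq_actionMatrix (hd : d ∣ labelModulus N k) :
    Zplus N k d = actionMatrix (labelKernel N k d) := by
  ext l x
  let term (s : ZMod (labelModulus N k)) : ℕ :=
    if ((labelModulus N k / d : ℕ) : ZMod (labelModulus N k)) *
        (grade l + s * halfGradeShift N k) = 0 ∧ x = s +ᵥ l then 1 else 0
  calc Zplus N k d l x
      = ∑ i ∈ Finset.Icc 1 d, term (i * (labelModulus N k / d) : ℕ) := by
        rw [Zplus, Matrix.of_apply]
        refine Finset.sum_congr rfl fun i _ => ?_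
        have hdvd := natCast_mul_natCast_eq_zero_iff (Nat.mul_div_cancel' hd)
          (grade l + i * (labelModulus N k / d) * halfGradeShift N k)
        rw [Nat.cast_add, Nat.cast_mul _ (halfGradeShift N k)] at hdvd
        simp only [term, hdvd]
        rw [mul_mul_kHat_div hd, mul_div_eq_stride_mul hd, ← natCast_shift, ite_zero_mul_ite_zero,
          mul_one]
    _ = ∑ s with (d : ZMod (labelModulus N k)) * s = 0, term s := sum_Icc_eq_sum_mul_eq_zero hd term
    _ = actionMatrix (labelKernel N k d) l x := by
        rw [Finset.sum_filter, actionMatrix, Matrix.of_apply]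
        refine Finset.sum_congr rfl fun s _ => ?_
        simp only [term, labelKernel, Contributes]
        grind

theorem labelKernel_dual (d : ℕ) (l : Weight N k) (s : ZMod (labelModulus N k)) :
    labelKernel N k d (dual l) (-s) = labelKernel N k d l s := by
  have hgrade := congrArg (ZMod.castHom (labelModulus_dvd N k) (ZMod (labelModulus N k)))
    (grade_dual l)
  simp only [map_natCast, map_neg] at hgrade
  simp only [labelKernel, hgrade, contributes_neg_neg]

theorem convolution_labelKernel (ha : a ∣ labelModulus N k) (hb : b ∣ labelModulus N k) :
    convolution (labelKernel N k a) (labelKernel N k b) =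
      Nat.gcd (mOf N k a) (mOf N k b) •
        labelKernel N k (prodLabel (labelModulus N k) (halfGradeShift N k) a b) := by
  funext l s
  simp only [convolution, labelKernel, grade_shift, ite_zero_mul_ite_zero, mul_one]
  rw [← Finset.card_filter, card_contributes _ ha hb, Pi.smul_apply, Pi.smul_apply, labelKernel,
    smul_eq_mul, mul_ite_zero, mul_one, mOf_eq ha, mOf_eq hb]

theorem zplus_mul_zplus (ha : a ∣ labelModulus N k) (hb : b ∣ labelModulus N k) :
    Zplus N k a * Zplus N k b = Nat.gcd (mOf N k a) (mOf N k b) •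
      Zplus N k (prodLabel (labelModulus N k) (halfGradeShift N k) a b) := by
  rw [zplus_eq_actionMatrix ha, zplus_eq_actionMatrix hb,
    zplus_eq_actionMatrix (prodLabel_dvd _ ha hb), actionMatrix_mul, convolution_labelKernel ha hb,
    actionMatrix_nsmul]

theorem zplus_one : Zplus N k 1 = 1 := by
  ext l x
  have hN : tau^[N] l = l := by rw [tau_iterate_eq_vadd, ZMod.natCast_self, zero_vadd]
  rw [Zplus, Matrix.of_apply, Finset.Icc_self, Finset.sum_singleton, Nat.div_one, one_mul, hN,
    if_pos (one_dvd _), one_mul, Matrix.one_apply]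
  simp only [eq_comm]

theorem zminus_eq_permMatrix :
    Zminus N k = (dual_involutive.toPerm (dual : Weight N k → Weight N k)).permMatrix ℕ := by
  ext l x
  simp only [Zminus, Matrix.of_apply, Equiv.Perm.permMatrix, PEquiv.toMatrix_apply,
    Equiv.toPEquiv_apply, Option.mem_some_iff, Function.Involutive.coe_toPerm,
    dual_involutive.eq_iff]

theorem zminus_sq : Zminus N k ^ 2 = Zplus N k 1 := by
  have hdual : dual_involutive.toPerm (dual : Weight N k → Weight N k) *
      dual_involutive.toPerm dual = 1 := Equiv.ext dual_involutive
  rw [zplus_one, zminus_eq_permMatrix, sq, ← Matrix.permMatrix_mul, hdual, Matrix.permMatrix_one]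

theorem zminus_mul_zplus (hd : d ∣ labelModulus N k) :
    Zminus N k * Zplus N k d = Zplus N k d * Zminus N k := by
  rw [zplus_eq_actionMatrix hd, zminus_eq_permMatrix]
  exact permMatrix_mul_actionMatrix _ (Equiv.neg _) dual_shift (labelKernel_dual d)

end Invariants

end SLModInv

theorem proposition4p5 (N k : ℕ) [NeZero N] (hN : 2 ≤ N) (hk : 1 ≤ k) :
    SLModInv.Zminus N k ^ 2 = SLModInv.Zplus N k 1 ∧
    (∀ d : ℕ, SLModInv.Admissible N k d →
      SLModInv.Zminus N k * SLModInv.Zplus N k d = SLModInv.Zplus N k d * SLModInv.Zminus N k) ∧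
    (∀ d' d'' : ℕ, SLModInv.Admissible N k d' → SLModInv.Admissible N k d'' →
      (∃! d : ℕ, SLModInv.IsProductLabel N k d' d'' d) ∧
      ∀ d : ℕ, SLModInv.IsProductLabel N k d' d'' d →
        SLModInv.Zplus N k d' * SLModInv.Zplus N k d'' =
          SLModInv.Zplus N k d'' * SLModInv.Zplus N k d' ∧
        SLModInv.Zplus N k d'' * SLModInv.Zplus N k d' =
          Nat.gcd (SLModInv.mOf N k d') (SLModInv.mOf N k d'') • SLModInv.Zplus N k d) := by
  refine ⟨SLModInv.zminus_sq,
    fun d hd => SLModInv.zminus_mul_zplus (SLModInv.admissible_iff.1 hd), fun a b ha hb => ?_⟩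
  rw [SLModInv.admissible_iff] at ha hb
  simp only [SLModInv.isProductLabel_iff (Nat.one_le_iff_ne_zero.1 hk) ha hb]
  refine ⟨existsUnique_eq, ?_⟩
  rintro _ rfl
  rw [SLModInv.zplus_mul_zplus ha hb, SLModInv.zplus_mul_zplus hb ha,
    SLModInv.prodLabel_comm _ _ b, Nat.gcd_comm (SLModInv.mOf N k b)]
  exact ⟨rfl, rfl⟩
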